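/- **Theorem 3.** Setting. A message $b$ of $k$ independent fair bits is encoded by an arbitrary map into a codeword $X\in\{0,1\}^n$, which is sent over $n$ independent uses of the binary symmetric channel with crossover probability $p_{ch}=\mathbb Q\big(\sqrt{\zeta P_T/\sigma_z^2}\big)$, where $\mathbb Q(x)=\int_x^\infty \frac1{\sqrt{2\pi}}e^{-t^2/2}\,dt$ and $\zeta,\sigma_z^2,P_T>0$ are the path loss, the noise variance and the transmit power (this is BPSK over an AWGN channel with hard decisions). The decoder is a circuit: a set of nodes lying on the lattice $(\lambda\mathbb Z)^2$, $\lambda>0$, inside a square $[0,l]^2$, among them $n$ distinct input nodes, each storing one bit of the channel output $Y$, and $k$ distinct output nodes, each holding one bit of the estimate $\widehat b$ at the end. It performs a fixed-message-length computation: finitely many messages are sent between pairs of distinct nodes, with order, endpoints and lengths in bits fixed in advance; each message is a function of the input bit of the transmitting node (if it has one) and of the messages which that node has received before, and each output bit is a function of the input bit (if any) of its node and of all messages which that node has received. The bit-meters of the computation are the sum over all messages of the number of bits times the Euclidean distance between the two nodes. The block-error probability is $P_e^{\mathrm{blk}}=\Pr(\widehat b\ne b)$. Claim. For every rate $R>0$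 and every $\delta>0$ there is an $N$, depending only on $R$ and $\delta$, such that for all $n\ge N$, all $k\ge Rn$, all $\zeta,\sigma_z^2,P_T>0$ with $$\log n>100\log\frac1{2p_{ch}},$$ all $\lambda>0$, all encoders and all decoders as above with $P_e^{\mathrm{blk}}\le 1-\delta$, $$\text{bit-meters}\ \ge\ \frac{k}{192}\sqrt{\frac{\log n}{\log\frac1{2p_{ch}}}}\;\lambda .$$ In particular, at fixed transmit power, the bit-meters per information bit grow at least like $\sqrt{\log n}$. -/

import Mathlib

noncomputable section

namespace InfoFriction

/-- The tail of the standard Gaussian law, `Q(x) = ∫_x^∞ (2π)^(-1/2) exp(-t²/2) dt`. -/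
def gaussianTail (x : ℝ) : ℝ :=
  ∫ t in Set.Ioi x, 1 / Real.sqrt (2 * Real.pi) * Real.exp (-t ^ 2 / 2)

/-- Channel Model `(ζ, σ²)` at transmit power `P`: BPSK over an AWGN channel with path loss `ζ`,
noise variance `σ²` and a hard decision at the receiver is a binary symmetric channel with this
crossover probability. -/
def crossover (zeta sigmaSq P : ℝ) : ℝ :=
  gaussianTail (Real.sqrt (zeta * P / sigmaSq))

/-- Probability that `n` independent uses of the binary symmetric channel with crossover
probability `p` turn the channel input `x` into the channel output `y`. -/
def bscProb {n : ℕ} (p : ℝ) (x y : Fin n → Bool) : ℝ :=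
  ∏ j, if y j = x j then 1 - p else p

/-- Average block-error probability `Pr (b̂ ≠ b)`: `b` consists of `k` independent fair bits, it is
encoded by `enc`, sent over the binary symmetric channel, and estimated by `dec`. -/
def blockErrorProb {n k : ℕ} (p : ℝ) (enc : (Fin k → Bool) → (Fin n → Bool))
    (dec : (Fin n → Bool) → (Fin k → Bool)) : ℝ :=
  ∑ b : Fin k → Bool, (1 / 2 : ℝ) ^ k *
    ∑ y : Fin n → Bool, bscProb p (enc b) y * (if dec y = b then 0 else 1)

/-- The parameters of the implementation model: the lattice spacing `λ` (the minimum distance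
between computational nodes) and the coefficient of information friction `μ` (the energy spent
per bit-meter, which plays no role for the number of bit-meters itself). -/
structure ImplementationModel where
  spacing : ℝ
  friction : ℝ
  spacing_pos : 0 < spacing
  friction_nonneg : 0 ≤ friction

/-- The square `[0, l] × [0, l]`. -/
def substrate (l : ℝ) : Set (EuclideanSpace ℝ (Fin 2)) :=
  {x | ∀ i, 0 ≤ x i ∧ x i ≤ l}

/-- The points `(s λ, t λ)` with integers `s`, `t`. -/
def squareLattice (spacing : ℝ) : Set (EuclideanSpace ℝ (Fin 2)) :=
  {x | ∀ i, ∃ s : ℤ, x i = s * spacing}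

/-- A circuit: a square substrate with a collection of computational nodes that are points of the
square lattice lying in the substrate. -/
structure Circuit (M : ImplementationModel) where
  side : ℝ
  nodes : Set (EuclideanSpace ℝ (Fin 2))
  nodes_subset : nodes ⊆ squareLattice M.spacing ∩ substrate side

/-- A fixed-message-length computation with `n` input bits and `k` output bits on a circuit.

There are `n` distinct input nodes, which store one input bit each, and `k` distinct output nodes,
which hold one output bit each at the end (an input node may also serve as an output node; all
other nodes are helper nodes). The computation consists of `steps` messages, in a predetermined
order; the `t`-th message goes over the link from node `src t` to node `dst t` and has the
predetermined length of `size t` bits. `message y t` is the content of the `t`-th message when the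
input of the computation is `y`; it is a function of what its transmitting node knows at that
time, namely its own input bit (if it has one) and the messages it has received so far. The output
bit is, in the same way, a function of what its output node knows at the end. -/
structure FixedLengthComputation {M : ImplementationModel} (C : Circuit M) (n k : ℕ) where
  inputNode : Fin n → C.nodes
  inputNode_injective : Function.Injective inputNode
  outputNode : Fin k → C.nodes
  outputNode_injective : Function.Injective outputNode
  steps : ℕ
  src : Fin steps → C.nodes
  dst : Fin steps → C.nodes
  src_ne_dst : ∀ t, src t ≠ dst t
  size : Fin steps → ℕ
  message : (Fin n → Bool) → (t : Fin steps) → Fin (size t) → Bool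
  message_local : ∀ (t : Fin steps) (y y' : Fin n → Bool),
    (∀ j, inputNode j = src t → y j = y' j) →
    (∀ s, s < t → dst s = src t → message y s = message y' s) →
    message y t = message y' t
  output : (Fin n → Bool) → Fin k → Bool
  output_local : ∀ (i : Fin k) (y y' : Fin n → Bool),
    (∀ j, inputNode j = outputNode i → y j = y' j) →
    (∀ s, dst s = outputNode i → message y s = message y' s) →
    output y i = output y' i

/-- The bit-meters of a computation: number of bits times Euclidean distance, summed over all the
messages on all the links. -/
def FixedLengthComputation.bitMeters {M : ImplementationModel} {C : Circuit M} {n k : ℕ}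
    (D : FixedLengthComputation C n k) : ℝ :=
  ∑ t, (D.size t : ℝ) *
    dist (D.src t : EuclideanSpace ℝ (Fin 2)) (D.dst t : EuclideanSpace ℝ (Fin 2))

end InfoFriction

end

noncomputable section

namespace InfoFriction

/-! Cut the substrate into cells of `a × a` lattice points. On a cell with `m` inputs the channel
law is at least the constant `p ^ m`, so it is a mixture: with probability `(2p) ^ m` the cell is
erased, that is, it sees fair coin flips independent of the message. An erased cell can get its `o`
output bits right only through the `i` bits entering from other cells, which costs a factor `2 ^ (i
- o)`. Expanding the product law over the set of erased cells makes these factors multiply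
(`successProb_le_prod_add`). If at most `k / 2` bits cross cell boundaries, many cells have `i < o`,
and the success probability is at most `exp (-k (2p) ^ A / (4A))` with `A = a²`
(`successProb_le_exp`).

So reliable decoding forces at least `k / 2` crossing bits for every grid. Among `a` diagonal shifts
of the grid, a message over distance `d` crosses in at most `2d / λ` of them; averaging gives
bit-meters at least `a k λ / 4`.

With `L = log (1 / (2p))` and `a` about `√(log n / L) / 4`, one has `(2p) ^ A ≥ n ^ (-1/16)`, and
the exponent is at least of order `√n`, uniformly as long as `L` is bounded below. Smaller `L` is
excluded by a strong converse, so `N` depends only on `R` and `δ`. -/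

/-- The probability `Pr (b̂ = b)` of correct decoding. -/
def successProb {n k : ℕ} (p : ℝ) (enc : (Fin k → Bool) → (Fin n → Bool))
    (dec : (Fin n → Bool) → (Fin k → Bool)) : ℝ :=
  (1 / 2 : ℝ) ^ k * ∑ b : Fin k → Bool,
    ∑ y : Fin n → Bool, bscProb p (enc b) y * (if dec y = b then 1 else 0)

/-! ### Success probability and the strong converse. -/

theorem sum_prod_bsc {ι : Type*} [Fintype ι] [DecidableEq ι] (p : ℝ) (x : ι → Bool) :
    ∑ y : ι → Bool, ∏ j, (if y j = x j then 1 - p else p) = 1 := by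
  rw [← Fintype.prod_sum (fun j (a : Bool) => if a = x j then 1 - p else p)]
  refine Finset.prod_eq_one fun j _ => ?_
  cases x j <;> simp

theorem blockErrorProb_eq {n k : ℕ} (p : ℝ) (enc : (Fin k → Bool) → (Fin n → Bool))
    (dec : (Fin n → Bool) → (Fin k → Bool)) :
    blockErrorProb p enc dec = 1 - successProb p enc dec := by
  have h : ∀ b : Fin k → Bool,
      ∑ y : Fin n → Bool, bscProb p (enc b) y * (if dec y = b then (0 : ℝ) else 1) =
        1 - ∑ y : Fin n → Bool, bscProb p (enc b) y * (if dec y = b then 1 else 0) := by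
    intro b
    rw [eq_sub_iff_add_eq, ← Finset.sum_add_distrib]
    refine Eq.trans (Finset.sum_congr rfl fun y _ => ?_) (sum_prod_bsc p (enc b))
    by_cases h : dec y = b <;> simp [h, bscProb]
  unfold blockErrorProb successProb
  simp_rw [h, ← Finset.mul_sum, Finset.sum_sub_distrib]
  rw [mul_sub]
  congr 1
  simp

/-- A strong converse for very noisy channels. -/
theorem successProb_le_pow {n k : ℕ} {p : ℝ} (hp0 : 0 ≤ p) (hp : p ≤ 1 / 2)
    (enc : (Fin k → Bool) → (Fin n → Bool)) (dec : (Fin n → Bool) → (Fin k → Bool)) :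
    successProb p enc dec ≤ (1 / 2 : ℝ) ^ k * (2 - 2 * p) ^ n := by
  unfold successProb
  refine mul_le_mul_of_nonneg_left ?_ (by positivity)
  rw [Finset.sum_comm]
  -- Each `y` is decoded to a single message, and no transition is likelier than `(1 - p) ^ n`
  -- because `p ≤ 1 / 2`.
  have h : ∀ y : Fin n → Bool,
      ∑ b, bscProb p (enc b) y * (if dec y = b then (1 : ℝ) else 0) ≤ (1 - p) ^ n := by
    intro y
    simp only [mul_ite, mul_one, mul_zero, Finset.sum_ite_eq, Finset.mem_univ, if_true]
    unfold bscProb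
    calc _ ≤ ∏ _j : Fin n, (1 - p) := by
          refine Finset.prod_le_prod (fun j _ => ?_) (fun j _ => ?_) <;> split_ifs <;> linarith
      _ = _ := by simp
  calc _ ≤ ∑ _y : Fin n → Bool, (1 - p) ^ n := Finset.sum_le_sum fun y _ => h y
    _ = _ := by
      simp [← mul_pow]
      ring

/-- Summing a product weight over the configurations for which the decision `dec z` equals the
message: the coordinates in `E` only restrict the message to a set `Z` of bounded size. -/
theorem sum_prod_mul_ite_le {κ β : Type*} [Fintype κ] [DecidableEq κ] [Fintype β] [DecidableEq β]
    [Nonempty β] {Y : κ → Type*} [∀ c, Fintype (Y c)] (E : Finset κ) (r : β → ∀ c, Y c → ℝ) (ρ : κ → ℝ)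
    (hr : ∀ b c z, 0 ≤ r b c z) (hρ : ∀ b c, ∑ z, r b c z = ρ c)
    (dec : (∀ c, Y c) → β) (Z : (∀ c : {c // c ∈ E}, Y c) → Finset β)
    (hZ : ∀ z : ∀ c, Y c, dec z ∈ Z (fun c => z c)) (K : ℝ) (hK : ∀ a, ((Z a).card : ℝ) ≤ K) :
    ∑ b, ∑ z : ∀ c, Y c, (∏ c ∈ Finset.univ \ E, r b c (z c)) * (if dec z = b then 1 else 0) ≤
      (∏ c ∈ E, (Fintype.card (Y c) : ℝ)) * K * ∏ c ∈ Finset.univ \ E, ρ c := by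
  classical
  have hρ0 : ∀ c, 0 ≤ ρ c := fun c =>
    hρ (Classical.arbitrary β) c ▸ Finset.sum_nonneg fun z _ => hr _ c z
  have key : ∀ b, ∑ z : ∀ c, Y c,
      (∏ c ∈ Finset.univ \ E, r b c (z c)) * (if dec z = b then 1 else 0) ≤
      ∑ a : (∀ c : {c // c ∈ E}, Y c),
        (if b ∈ Z a then 1 else 0) * ∏ c ∈ Finset.univ \ E, ρ c := by
    intro b
    rw [← (Equiv.piEquivPiSubtypeProd (fun c => c ∈ E) Y).symm.sum_comp, Fintype.sum_prod_type]
    refine Finset.sum_le_sum fun a _ => ?_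
    have hprod : ∀ g : κ → ℝ, ∏ c ∈ Finset.univ \ E, g c = ∏ c : {c // c ∉ E}, g c := by
      intro g
      rw [← Finset.prod_subtype (Finset.univ \ E) (by simp)]
    have hres : ∀ w : (∀ c : {c // c ∉ E}, Y c), ∀ c : {c // c ∉ E},
        (Equiv.piEquivPiSubtypeProd (fun c => c ∈ E) Y).symm (a, w) c = w c := by
      intro w c
      simp [Equiv.piEquivPiSubtypeProd, c.2]
    have hresE : ∀ w : (∀ c : {c // c ∉ E}, Y c),
        (fun c : {c // c ∈ E} =>
          (Equiv.piEquivPiSubtypeProd (fun c => c ∈ E) Y).symm (a, w) c) = a := by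
      intro w
      funext c
      simp [Equiv.piEquivPiSubtypeProd, c.2]
    -- A correct decision forces `b ∈ Z a`. Keeping only this condition decouples the coordinates
    -- outside `E`, which then sum freely.
    calc _ ≤ ∑ w : (∀ c : {c // c ∉ E}, Y c),
            (if b ∈ Z a then 1 else 0) * ∏ c : {c // c ∉ E}, r b c (w c) := by
          refine Finset.sum_le_sum fun w _ => ?_
          rw [hprod, mul_comm]
          simp only [hres]
          refine mul_le_mul_of_nonneg_right ?_ (Finset.prod_nonneg fun c _ => hr _ _ _)
          by_cases hd : dec ((Equiv.piEquivPiSubtypeProd (fun c => c ∈ E) Y).symm (a, w)) = b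
          · have := hZ ((Equiv.piEquivPiSubtypeProd (fun c => c ∈ E) Y).symm (a, w))
            rw [hresE, hd] at this
            rw [if_pos this]
            split_ifs <;> norm_num
          · rw [if_neg hd]
            split_ifs <;> norm_num
      _ = _ := by
          rw [← Finset.mul_sum, ← Fintype.prod_sum (fun (c : {c // c ∉ E}) z => r b c z), hprod]
          simp [hρ]
  calc _ ≤ ∑ b, ∑ a : (∀ c : {c // c ∈ E}, Y c),
        (if b ∈ Z a then 1 else 0) * ∏ c ∈ Finset.univ \ E, ρ c :=
        Finset.sum_le_sum fun b _ => key b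
    _ = ∑ a : (∀ c : {c // c ∈ E}, Y c), ((Z a).card : ℝ) * ∏ c ∈ Finset.univ \ E, ρ c := by
        rw [Finset.sum_comm]
        refine Finset.sum_congr rfl fun a _ => ?_
        rw [← Finset.sum_mul]
        simp
    _ ≤ ∑ _a : (∀ c : {c // c ∈ E}, Y c), K * ∏ c ∈ Finset.univ \ E, ρ c := by
        refine Finset.sum_le_sum fun a _ => ?_
        exact mul_le_mul_of_nonneg_right (hK a) (Finset.prod_nonneg fun c _ => hρ0 c)
    _ = _ := by
        rw [Finset.sum_const, Finset.card_univ, Fintype.card_pi, nsmul_eq_mul, Nat.cast_prod,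
          ← Finset.prod_subtype E (fun _ => Iff.rfl) (fun c => (Fintype.card (Y c) : ℝ)), mul_assoc]

/-! ### Information flow into a union of cells. -/

namespace FixedLengthComputation

variable {M : ImplementationModel} {C : Circuit M} {n k : ℕ} (D : FixedLengthComputation C n k)
  {κ : Type*} [DecidableEq κ] (f : C.nodes → κ)

/-- The number of bits that enter cell `c` from other cells. -/
def incomingBits (c : κ) : ℕ :=
  ∑ t with f (D.dst t) = c ∧ f (D.src t) ≠ f (D.dst t), D.size t

/-- The number of input nodes in cell `c`. -/
def inputCount (c : κ) : ℕ := Fintype.card {j // f (D.inputNode j) = c}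

/-- The number of output nodes in cell `c`. -/
def outputCount (c : κ) : ℕ := Fintype.card {i // f (D.outputNode i) = c}

theorem sum_incomingBits (E : Finset κ) :
    ∑ c ∈ E, D.incomingBits f c =
      ∑ t with f (D.dst t) ∈ E ∧ f (D.src t) ≠ f (D.dst t), D.size t := by
  unfold incomingBits
  rw [← Finset.sum_fiberwise_of_maps_to (t := E) (g := fun t => f (D.dst t)) (by simp +contextual)]
  refine Finset.sum_congr rfl fun c hc => Finset.sum_congr ?_ fun _ _ => rfl
  ext t
  simp only [Finset.mem_filter, Finset.mem_univ, true_and]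
  constructor
  · rintro ⟨h, h'⟩
    exact ⟨⟨h ▸ hc, h'⟩, h⟩
  · rintro ⟨⟨_, h'⟩, h⟩
    exact ⟨h, h'⟩

theorem card_outputNode_mem (E : Finset κ) :
    Fintype.card {i // f (D.outputNode i) ∈ E} = ∑ c ∈ E, D.outputCount f c := by
  simp only [outputCount, Fintype.card_subtype]
  rw [Finset.card_eq_sum_card_fiberwise (t := E) (f := fun i => f (D.outputNode i))
    (fun i hi => by simpa using hi)]
  refine Finset.sum_congr rfl fun c hc => congrArg _ ?_
  ext i
  simp only [Finset.mem_filter, Finset.mem_univ, true_and]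
  exact ⟨fun h => h.2, fun h => ⟨h ▸ hc, h⟩⟩

variable {D f}

/-- The messages received in a union of cells are determined by the inputs stored there and by
the messages coming from other cells. -/
theorem message_eq_of_incoming_eq {E : Finset κ} {y y' : Fin n → Bool}
    (hy : ∀ j, f (D.inputNode j) ∈ E → y j = y' j)
    (hm : ∀ t, f (D.dst t) ∈ E → f (D.src t) ≠ f (D.dst t) → D.message y t = D.message y' t)
    (t : Fin D.steps) (ht : f (D.dst t) ∈ E) : D.message y t = D.message y' t := by
  induction t using WellFoundedLT.induction with
  | ind t ih =>
    by_cases hs : f (D.src t) = f (D.dst t)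
    · refine D.message_local t y y' (fun j hj => hy j ?_) (fun s hst hs' => ih s hst ?_)
      · rwa [hj, hs]
      · rwa [hs', hs]
    · exact hm t ht hs

theorem output_eq_of_incoming_eq {E : Finset κ} {y y' : Fin n → Bool}
    (hy : ∀ j, f (D.inputNode j) ∈ E → y j = y' j)
    (hm : ∀ t, f (D.dst t) ∈ E → f (D.src t) ≠ f (D.dst t) → D.message y t = D.message y' t)
    (i : Fin k) (hi : f (D.outputNode i) ∈ E) : D.output y i = D.output y' i :=
  D.output_local i y y' (fun j hj => hy j (by rwa [hj]))
    (fun s hs => message_eq_of_incoming_eq hy hm s (by rwa [hs]))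

variable (D f)

open Classical in
/-- The messages `b` that agree, on the output nodes in the cells of `E`, with the output for some
input that agrees with `y₀` in the cells of `E`. -/
def consistentMessages (E : Finset κ) (y₀ : Fin n → Bool) : Finset (Fin k → Bool) :=
  {b | ∃ y : Fin n → Bool, (∀ j, f (D.inputNode j) ∈ E → y j = y₀ j) ∧
    ∀ i, f (D.outputNode i) ∈ E → D.output y i = b i}

/-- A cut-set count: with the inputs in `E` fixed, a consistent message is recovered from the
contents of the messages entering cells of `E` (for a witness input) together with its own bits
outside `E`. -/
theorem card_consistentMessages_le [Fintype κ] (E : Finset κ) (y₀ : Fin n → Bool) :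
    (D.consistentMessages f E y₀).card ≤
      2 ^ (∑ c ∈ E, D.incomingBits f c) * 2 ^ (∑ c ∈ Finset.univ \ E, D.outputCount f c) := by
  classical
  let I := {t // f (D.dst t) ∈ E ∧ f (D.src t) ≠ f (D.dst t)}
  have hw : ∀ b : D.consistentMessages f E y₀, ∃ y : Fin n → Bool,
      (∀ j, f (D.inputNode j) ∈ E → y j = y₀ j) ∧
        ∀ i, f (D.outputNode i) ∈ E → D.output y i = b.1 i := fun b => by
    simpa [consistentMessages] using b.2
  choose w hw₁ hw₂ using hw
  let F : D.consistentMessages f E y₀ →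
      (∀ t : I, Fin (D.size t) → Bool) ×
        ({i // f (D.outputNode i) ∈ Finset.univ \ E} → Bool) :=
    fun b => (fun t => D.message (w b) t, fun i => b.1 i)
  have hF : Function.Injective F := by
    intro b b' h
    have h₁ := congrArg Prod.fst h
    have h₂ := congrArg Prod.snd h
    ext i
    by_cases hi : f (D.outputNode i) ∈ E
    · rw [← hw₂ b i hi, ← hw₂ b' i hi]
      refine output_eq_of_incoming_eq (fun j hj => ?_) (fun t ht ht' => ?_) i hi
      · rw [hw₁ b j hj, hw₁ b' j hj]
      · exact congrFun h₁ ⟨t, ht, ht'⟩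
    · rw [show b.1 i = b'.1 i from congrFun h₂ ⟨i, by simpa using hi⟩]
  have := Fintype.card_le_of_injective F hF
  rw [Fintype.card_coe, Fintype.card_prod, Fintype.card_pi, Fintype.card_fun,
    card_outputNode_mem] at this
  refine this.trans_eq ?_
  congr 1
  rw [sum_incomingBits, ← Finset.prod_pow_eq_pow_sum]
  rw [Finset.prod_subtype (p := fun t => f (D.dst t) ∈ E ∧ f (D.src t) ≠ f (D.dst t))
    (F := Subtype.fintype _) _ (by simp)]
  simp [I]

end FixedLengthComputation

/-! ### Erasure decomposition of the channel over the cells. -/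

/-- Sorting the coordinates of a vector by the fibers of a map. -/
def piFiberEquiv {ι κ : Type*} (g : ι → κ) (β : Type*) :
    (∀ c, {j // g j = c} → β) ≃ (ι → β) where
  toFun z j := z (g j) ⟨j, rfl⟩
  invFun y _ j := y j
  left_inv z := by
    funext c ⟨j, hj⟩
    subst hj
    rfl
  right_inv _ := rfl

theorem piFiberEquiv_apply {ι κ β : Type*} {g : ι → κ} (z : ∀ c, {j // g j = c} → β) {c : κ}
    (j : {j // g j = c}) : piFiberEquiv g β z j = z c j := by
  obtain ⟨j, rfl⟩ := j
  rfl

namespace FixedLengthComputation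

variable {M : ImplementationModel} {C : Circuit M} {n k : ℕ} (D : FixedLengthComputation C n k)
  {κ : Type*} [Fintype κ] [DecidableEq κ] (f : C.nodes → κ)

theorem half_pow_mul_pow_eq (E : Finset κ) :
    (1 / 2 : ℝ) ^ k * (2 ^ (∑ c ∈ E, D.incomingBits f c) *
      2 ^ (∑ c ∈ Finset.univ \ E, D.outputCount f c)) =
      ∏ c ∈ E, (2 : ℝ) ^ D.incomingBits f c / 2 ^ D.outputCount f c := by
  have hk : k = ∑ c ∈ E, D.outputCount f c + ∑ c ∈ Finset.univ \ E, D.outputCount f c := by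
    have h := D.card_outputNode_mem f Finset.univ
    rw [← Finset.sum_sdiff (Finset.subset_univ E), add_comm] at h
    simpa using h
  rw [Finset.prod_div_distrib, Finset.prod_pow_eq_pow_sum, Finset.prod_pow_eq_pow_sum]
  have hk' : (1 / 2 : ℝ) ^ k =
      (1 / 2) ^ (∑ c ∈ E, D.outputCount f c + ∑ c ∈ Finset.univ \ E, D.outputCount f c) :=
    congrArg _ hk
  rw [hk', pow_add, one_div, inv_pow, inv_pow]
  field_simp

/-- Here `2 ^ inputCount * u c` is the erasure probability of cell `c`. The law of each cell splits
as `u c` plus a nonnegative rest of constant total mass; `E` in the expansion is the set of erased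
cells. Leaving `u` free allows erasing only the cells where this helps. -/
theorem successProb_le_prod_add {p : ℝ} (hp0 : 0 ≤ p) (hp : p ≤ 1 / 2)
    (enc : (Fin k → Bool) → (Fin n → Bool)) (u : κ → ℝ) (hu0 : ∀ c, 0 ≤ u c)
    (hu : ∀ c, u c ≤ p ^ D.inputCount f c) :
    successProb p enc D.output ≤
      ∏ c, (2 ^ D.inputCount f c * u c * (2 ^ D.incomingBits f c / 2 ^ D.outputCount f c) +
        (1 - 2 ^ D.inputCount f c * u c)) := by
  classical
  let g : Fin n → κ := fun j => f (D.inputNode j)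
  let W : (Fin k → Bool) → ∀ c, ({j // g j = c} → Bool) → ℝ :=
    fun b c z => ∏ j, if z j = enc b j then 1 - p else p
  have hW : ∀ b (z : ∀ c, {j // g j = c} → Bool),
      bscProb p (enc b) (piFiberEquiv g Bool z) = ∏ c, (u c + (W b c (z c) - u c)) := by
    intro b z
    unfold bscProb
    rw [← Fintype.prod_fiberwise g]
    refine Finset.prod_congr rfl fun c _ => ?_
    rw [add_sub_cancel]
    refine Finset.prod_congr rfl fun j _ => ?_
    rw [piFiberEquiv_apply]
  have hcard : ∀ c, (Fintype.card ({j // g j = c} → Bool) : ℝ) = 2 ^ D.inputCount f c := by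
    intro c
    rw [Fintype.card_fun]
    simp [inputCount, g]
  have hr : ∀ b c z, 0 ≤ W b c z - u c := by
    intro b c z
    refine sub_nonneg.2 ((hu c).trans ?_)
    calc p ^ D.inputCount f c = ∏ _j : {j // g j = c}, p := by simp [inputCount, g]
      _ ≤ _ := Finset.prod_le_prod (fun j _ => hp0) (fun j _ => by split_ifs <;> linarith)
  have hρ : ∀ b c, ∑ z, (W b c z - u c) = 1 - 2 ^ D.inputCount f c * u c := by
    intro b c
    rw [Finset.sum_sub_distrib, sum_prod_bsc p (fun j : {j // g j = c} => enc b j),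
      Finset.sum_const, Finset.card_univ, nsmul_eq_mul, hcard]
  have hterm : ∀ E : Finset κ, (1 / 2 : ℝ) ^ k * ∑ b, ∑ z : ∀ c, {j // g j = c} → Bool,
      (∏ c ∈ Finset.univ \ E, (W b c (z c) - u c)) *
        (if D.output (piFiberEquiv g Bool z) = b then 1 else 0) ≤
      (∏ c ∈ E, 2 ^ D.inputCount f c * ((2 : ℝ) ^ D.incomingBits f c / 2 ^ D.outputCount f c)) *
        ∏ c ∈ Finset.univ \ E, (1 - 2 ^ D.inputCount f c * u c) := by
    intro E
    -- The default `false` is immaterial: `consistentMessages` reads `y₀` only at inputs in `E`.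
    let y₀ : (∀ c : {c // c ∈ E}, {j // g j = c} → Bool) → Fin n → Bool :=
      fun a j => if h : g j ∈ E then a ⟨g j, h⟩ ⟨j, rfl⟩ else false
    have h := sum_prod_mul_ite_le E (fun b c z => W b c z - u c) _ hr hρ
      (fun z => D.output (piFiberEquiv g Bool z))
      (fun a => D.consistentMessages f E (y₀ a)) (fun z => by
        simp only [consistentMessages, Finset.mem_filter, Finset.mem_univ, true_and]
        refine ⟨piFiberEquiv g Bool z, fun j hj => ?_, fun _ _ => rfl⟩
        simp only [y₀]
        rw [dif_pos hj]
        rfl) (2 ^ (∑ c ∈ E, D.incomingBits f c) *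
          2 ^ (∑ c ∈ Finset.univ \ E, D.outputCount f c)) (fun a => by
        exact_mod_cast D.card_consistentMessages_le f E (y₀ a))
    refine (mul_le_mul_of_nonneg_left h (by positivity)).trans_eq ?_
    rw [Finset.prod_mul_distrib, ← D.half_pow_mul_pow_eq f E]
    simp only [hcard]
    ring
  unfold successProb
  simp_rw [← (piFiberEquiv g Bool).sum_comp, hW, Finset.prod_add, Finset.sum_mul]
  calc (1 / 2 : ℝ) ^ k * ∑ b, ∑ z : ∀ c, {j // g j = c} → Bool,
        ∑ E ∈ Finset.univ.powerset, ((∏ c ∈ E, u c) *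
          ∏ c ∈ Finset.univ \ E, (W b c (z c) - u c)) *
          (if D.output (piFiberEquiv g Bool z) = b then 1 else 0)
      = ∑ E ∈ Finset.univ.powerset, (∏ c ∈ E, u c) * ((1 / 2 : ℝ) ^ k *
          ∑ b, ∑ z : ∀ c, {j // g j = c} → Bool,
            (∏ c ∈ Finset.univ \ E, (W b c (z c) - u c)) *
            (if D.output (piFiberEquiv g Bool z) = b then 1 else 0)) := by
        simp_rw [Finset.mul_sum]
        conv_lhs =>
          enter [2, b]
          rw [Finset.sum_comm]
        rw [Finset.sum_comm]
        refine Finset.sum_congr rfl fun E _ => Finset.sum_congr rfl fun b _ =>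
          Finset.sum_congr rfl fun z _ => ?_
        ring
    _ ≤ ∑ E ∈ Finset.univ.powerset, (∏ c ∈ E, u c) * ((∏ c ∈ E, 2 ^ D.inputCount f c *
          ((2 : ℝ) ^ D.incomingBits f c / 2 ^ D.outputCount f c)) *
        ∏ c ∈ Finset.univ \ E, (1 - 2 ^ D.inputCount f c * u c)) :=
        Finset.sum_le_sum fun E _ =>
          mul_le_mul_of_nonneg_left (hterm E) (Finset.prod_nonneg fun c _ => hu0 c)
    _ = _ := by
        refine Finset.sum_congr rfl fun E _ => ?_
        rw [← mul_assoc, ← Finset.prod_mul_distrib]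
        congr 1
        exact Finset.prod_congr rfl fun c _ => by ring

/-- If every cell has at most `A` inputs and outputs and at most `k / 2` bits are exchanged between
different cells, then correct decoding is unlikely. -/
theorem successProb_le_exp {p : ℝ} (hp0 : 0 ≤ p) (hp : p ≤ 1 / 2)
    (enc : (Fin k → Bool) → (Fin n → Bool)) {A : ℕ} (hA : 0 < A)
    (hin : ∀ c, D.inputCount f c ≤ A) (hout : ∀ c, D.outputCount f c ≤ A)
    (hbits : ((∑ c, D.incomingBits f c : ℕ) : ℝ) ≤ k / 2) :
    successProb p enc D.output ≤ Real.exp (-(k * (2 * p) ^ A / (4 * A))) := by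
  classical
  let G : Finset κ := {c | D.incomingBits f c < D.outputCount f c}
  have hk : (k : ℝ) = ∑ c, (D.outputCount f c : ℝ) := by
    have h := D.card_outputNode_mem f Finset.univ
    simp only [Finset.mem_univ, Fintype.card_subtype_true, Fintype.card_fin] at h
    exact_mod_cast h
  -- Outputs exceed incoming bits by at least `k / 2` in total; only cells of `G` contribute
  -- positively, each at most `A`.
  have hG : (k : ℝ) / 2 ≤ G.card * A := by
    calc (k : ℝ) / 2 ≤ ∑ c, ((D.outputCount f c : ℝ) - D.incomingBits f c) := by
          rw [Finset.sum_sub_distrib, ← hk]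
          push_cast at hbits
          linarith
      _ ≤ ∑ c, (if c ∈ G then (A : ℝ) else 0) := by
          refine Finset.sum_le_sum fun c _ => ?_
          have h := hout c
          have h' : (D.outputCount f c : ℝ) ≤ A := by exact_mod_cast h
          have h0 : (0 : ℝ) ≤ D.incomingBits f c := by positivity
          split_ifs with hc
          · linarith
          · have : D.outputCount f c ≤ D.incomingBits f c := by simpa [G] using hc
            have : (D.outputCount f c : ℝ) ≤ D.incomingBits f c := by exact_mod_cast this
            linarith
      _ = G.card * A := by simp
  have hA' : (0 : ℝ) < A := by exact_mod_cast hA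
  have hq0 : 0 ≤ (2 * p) ^ A := by positivity
  have hq1 : (2 * p) ^ A ≤ 1 := pow_le_one₀ (by positivity) (by linarith)
  -- Cells of `G` are erased as much as possible, the others never, so that these contribute the
  -- factor `1`.
  have h := D.successProb_le_prod_add f hp0 hp enc
    (fun c => if c ∈ G then p ^ D.inputCount f c else 0)
    (fun c => by split_ifs <;> positivity)
    (fun c => by split_ifs <;> first | exact le_rfl | positivity)
  refine h.trans ?_
  calc _ ≤ ∏ c, (if c ∈ G then 1 - (2 * p) ^ A / 2 else 1) := by
        refine Finset.prod_le_prod (fun c _ => ?_) (fun c _ => ?_)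
        · have hqc : (2 * p) ^ D.inputCount f c ≤ 1 := pow_le_one₀ (by positivity) (by linarith)
          have : (0 : ℝ) ≤ (2 * p) ^ D.inputCount f c *
              (2 ^ D.incomingBits f c / 2 ^ D.outputCount f c) := by positivity
          split_ifs
          · rw [← mul_pow]
            linarith
          · simp
        · split_ifs with hc
          · rw [← mul_pow]
            have hqc : (2 * p) ^ A ≤ (2 * p) ^ D.inputCount f c :=
              pow_le_pow_of_le_one (by positivity) (by linarith) (hin c)
            -- By integrality at least one output bit is missing, so erasure costs a factor `1 / 2`.
            have hc' : D.incomingBits f c + 1 ≤ D.outputCount f c := by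
              simpa [G, Nat.succ_le_iff] using hc
            have hhalf : (2 : ℝ) ^ D.incomingBits f c / 2 ^ D.outputCount f c ≤ 1 / 2 := by
              rw [div_le_div_iff₀ (by positivity) (by positivity), one_mul, ← pow_succ]
              exact pow_le_pow_right₀ (by norm_num) hc'
            have := mul_le_mul_of_nonneg_left hhalf
              (by positivity : (0 : ℝ) ≤ (2 * p) ^ D.inputCount f c)
            linarith
          · simp
    _ = (1 - (2 * p) ^ A / 2) ^ G.card := by simp
    _ ≤ Real.exp (-((2 * p) ^ A / 2)) ^ G.card := by
        refine pow_le_pow_left₀ (by linarith) ?_ _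
        linarith [Real.add_one_le_exp (-((2 * p) ^ A / 2))]
    _ = Real.exp (-(G.card * ((2 * p) ^ A / 2))) := by
        rw [← Real.exp_nat_mul]
        ring_nf
    _ ≤ _ := by
        rw [Real.exp_le_exp, neg_le_neg_iff, div_le_iff₀ (by positivity)]
        nlinarith [mul_le_mul_of_nonneg_left hG hq0]

end FixedLengthComputation

/-! ### The crossover probability lies in `(0, 1/2]`. -/

theorem integrable_gaussian_density :
    MeasureTheory.Integrable (fun t : ℝ => 1 / Real.sqrt (2 * Real.pi) * Real.exp (-t ^ 2 / 2)) := by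
  refine ((integrable_exp_neg_mul_sq (b := 1 / 2) (by norm_num)).const_mul
    (1 / Real.sqrt (2 * Real.pi))).congr (Filter.Eventually.of_forall fun t => ?_)
  dsimp only
  ring_nf

theorem gaussianTail_pos (x : ℝ) : 0 < gaussianTail x := by
  unfold gaussianTail
  rw [MeasureTheory.setIntegral_pos_iff_support_of_nonneg_ae
    (Filter.Eventually.of_forall fun t => by positivity)
    integrable_gaussian_density.integrableOn]
  have : (Function.support fun t : ℝ =>
      1 / Real.sqrt (2 * Real.pi) * Real.exp (-t ^ 2 / 2)) = Set.univ := by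
    ext t
    simp only [Function.mem_support, Set.mem_univ, iff_true]
    positivity
  rw [this, Set.univ_inter, Real.volume_Ioi]
  exact ENNReal.zero_lt_top

theorem gaussianTail_zero : gaussianTail 0 = 1 / 2 := by
  have h := integral_gaussian_Ioi (1 / 2)
  have h2 : Real.pi / (1 / 2) = 2 * Real.pi := by ring
  have h3 : ∀ t : ℝ, -t ^ 2 / 2 = -(1 / 2) * t ^ 2 := fun t => by ring
  unfold gaussianTail
  simp_rw [h3]
  rw [MeasureTheory.integral_const_mul, h, h2]
  have : Real.sqrt (2 * Real.pi) ≠ 0 := by positivity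
  field_simp

theorem gaussianTail_le_half {x : ℝ} (hx : 0 ≤ x) : gaussianTail x ≤ 1 / 2 := by
  rw [← gaussianTail_zero]
  exact MeasureTheory.setIntegral_mono_set integrable_gaussian_density.integrableOn
    (Filter.Eventually.of_forall fun t => by positivity)
    (Set.Ioi_subset_Ioi hx).eventuallyLE

/-! ### Shifted grids on the lattice. -/

/-- Hermite's identity for integers. -/
theorem sum_range_add_ediv {a : ℕ} (ha : 0 < a) (x : ℤ) :
    ∑ u ∈ Finset.range a, (x + u) / (a : ℤ) = x := by
  have ha' : (a : ℤ) ≠ 0 := by exact_mod_cast ha.ne'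
  -- Passing from `x` to `x + 1` trades the term `x / a` for `(x + a) / a = x / a + 1`.
  have hstep : ∀ x : ℤ, ∑ u ∈ Finset.range a, (x + 1 + u) / (a : ℤ) =
      ∑ u ∈ Finset.range a, (x + u) / (a : ℤ) + 1 := by
    intro x
    have h := Finset.sum_range_succ' (fun u : ℕ => (x + u) / (a : ℤ)) a
    rw [Finset.sum_range_succ, Int.add_ediv_of_dvd_right (dvd_refl _), Int.ediv_self ha'] at h
    push_cast at h
    simp only [add_zero] at h
    have h' : ∀ u : ℕ, x + 1 + (u : ℤ) = x + (u + 1) := fun u => by ring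
    simp_rw [h']
    linarith
  induction x using Int.induction_on with
  | zero =>
    refine Finset.sum_eq_zero fun u hu => ?_
    rw [zero_add]
    exact Int.ediv_eq_zero_of_lt (by positivity) (by exact_mod_cast Finset.mem_range.1 hu)
  | succ i ih => rw [hstep, ih]
  | pred i ih =>
    have h := hstep (-(i : ℤ) - 1)
    rw [sub_add_cancel, ih] at h
    linarith

/-- For `x ≤ y` the quotients are ordered, and differ by at least `1` when distinct, so the count is
at most the sum of the differences, which Hermite's identity evaluates. -/
theorem card_ediv_ne_le {a : ℕ} (ha : 0 < a) (x y : ℤ) :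
    (((Finset.range a).filter fun u : ℕ => (x + u) / (a : ℤ) ≠ (y + u) / (a : ℤ)).card : ℤ) ≤
      |x - y| := by
  wlog hxy : x ≤ y generalizing x y
  · rw [abs_sub_comm]
    simpa only [ne_comm] using this y x (le_of_not_ge hxy)
  rw [abs_sub_comm, abs_of_nonneg (sub_nonneg.2 hxy)]
  calc _ = ∑ u ∈ Finset.range a, if (x + u) / (a : ℤ) ≠ (y + u) / (a : ℤ) then (1 : ℤ) else 0 := by
        rw [Finset.card_filter]
        push_cast
        rfl
    _ ≤ ∑ u ∈ Finset.range a, ((y + u) / (a : ℤ) - (x + u) / (a : ℤ)) := by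
        refine Finset.sum_le_sum fun u _ => ?_
        have : (x + u) / (a : ℤ) ≤ (y + u) / (a : ℤ) :=
          Int.ediv_le_ediv (by exact_mod_cast ha) (by linarith)
        split_ifs with h
        · have := lt_of_le_of_ne this h
          linarith
        · linarith
    _ = y - x := by
        rw [Finset.sum_sub_distrib, sum_range_add_ediv ha, sum_range_add_ediv ha]

namespace Circuit

variable {M : ImplementationModel} (C : Circuit M)

/-- The integer coordinates of a node. -/
def latticeCoord (v : C.nodes) (i : Fin 2) : ℤ := ⌊(v : EuclideanSpace ℝ (Fin 2)) i / M.spacing⌋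

theorem latticeCoord_mul_spacing (v : C.nodes) (i : Fin 2) :
    C.latticeCoord v i * M.spacing = (v : EuclideanSpace ℝ (Fin 2)) i := by
  obtain ⟨s, hs⟩ := (C.nodes_subset v.2).1 i
  rw [latticeCoord, hs, mul_div_cancel_right₀ _ M.spacing_pos.ne', Int.floor_intCast]

theorem node_ext {v w : C.nodes} (h : ∀ i, C.latticeCoord v i = C.latticeCoord w i) : v = w := by
  ext i
  rw [← C.latticeCoord_mul_spacing v, ← C.latticeCoord_mul_spacing w, h]

theorem abs_latticeCoord_sub_mul_spacing_le (v w : C.nodes) (i : Fin 2) :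
    ((|C.latticeCoord v i - C.latticeCoord w i| : ℤ) : ℝ) * M.spacing ≤
      dist (v : EuclideanSpace ℝ (Fin 2)) (w : EuclideanSpace ℝ (Fin 2)) := by
  have h := PiLp.norm_apply_le ((v : EuclideanSpace ℝ (Fin 2)) - (w : EuclideanSpace ℝ (Fin 2))) i
  rw [PiLp.sub_apply, Real.norm_eq_abs, ← C.latticeCoord_mul_spacing v,
    ← C.latticeCoord_mul_spacing w, ← sub_mul, abs_mul, abs_of_pos M.spacing_pos] at h
  rw [dist_eq_norm]
  push_cast
  exact h

/-- The cell of a node in the grid of `a × a` blocks of lattice points, shifted along the diagonal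
by `u` steps. -/
def gridCell (a u : ℕ) (v : C.nodes) : ℤ × ℤ :=
  ((C.latticeCoord v 0 + u) / a, (C.latticeCoord v 1 + u) / a)

/-- Provides the finite index type of cells over which the product bound is taken. -/
theorem finite_range_gridCell {a : ℕ} (ha : 0 < a) (u : ℕ) :
    (Set.range (C.gridCell a u)).Finite := by
  refine (Set.finite_Icc ((0, 0) : ℤ × ℤ)
    ((⌊C.side / M.spacing⌋ + u) / a, (⌊C.side / M.spacing⌋ + u) / a)).subset ?_
  rintro _ ⟨v, rfl⟩
  have h := (C.nodes_subset v.2).2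
  have h0 : ∀ i, 0 ≤ C.latticeCoord v i := fun i =>
    Int.floor_nonneg.2 (div_nonneg (h i).1 M.spacing_pos.le)
  have h1 : ∀ i, C.latticeCoord v i ≤ ⌊C.side / M.spacing⌋ := fun i =>
    Int.floor_le_floor (div_le_div_of_nonneg_right (h i).2 M.spacing_pos.le)
  refine ⟨⟨?_, ?_⟩, ⟨?_, ?_⟩⟩
  · exact Int.ediv_nonneg (add_nonneg (h0 0) (by positivity)) (by positivity)
  · exact Int.ediv_nonneg (add_nonneg (h0 1) (by positivity)) (by positivity)
  · exact Int.ediv_le_ediv (by exact_mod_cast ha) (by linarith [h1 0])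
  · exact Int.ediv_le_ediv (by exact_mod_cast ha) (by linarith [h1 1])

/-- Within a cell the quotients by `a` agree, so a node is determined by its two remainders. -/
theorem card_gridCell_eq_le {ι : Type*} [Fintype ι] {a : ℕ} (ha : 0 < a) (u : ℕ) {g : ι → C.nodes}
    (hg : Function.Injective g) (c : ℤ × ℤ) :
    Fintype.card {j // C.gridCell a u (g j) = c} ≤ a * a := by
  have ha' : (0 : ℤ) < a := by exact_mod_cast ha
  let S : Finset (ℤ × ℤ) := Finset.Ico (0 : ℤ) a ×ˢ Finset.Ico (0 : ℤ) a
  let F : {j // C.gridCell a u (g j) = c} → S := fun j =>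
    ⟨((C.latticeCoord (g j) 0 + u) % a, (C.latticeCoord (g j) 1 + u) % a), by
      simp [S, Int.emod_nonneg _ ha'.ne', Int.emod_lt_of_pos _ ha']⟩
  have hF : Function.Injective F := by
    rintro ⟨j, hj⟩ ⟨j', hj'⟩ h
    have h := congrArg Subtype.val h
    simp only [F, Prod.mk.injEq] at h
    have hd := hj.trans hj'.symm
    simp only [gridCell, Prod.mk.injEq] at hd
    refine Subtype.ext (hg (C.node_ext ?_))
    have key : ∀ x y : ℤ, x / a = y / a → x % a = y % a → x = y := fun x y h₁ h₂ => by
      rw [← Int.mul_ediv_add_emod x a, ← Int.mul_ediv_add_emod y a, h₁, h₂]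
    rw [Fin.forall_fin_two]
    exact ⟨add_right_cancel (key _ _ hd.1 h.1), add_right_cancel (key _ _ hd.2 h.2)⟩
  have := Fintype.card_le_of_injective F hF
  simpa [S] using this

/-- Averaging over the shifts, two nodes are rarely in different cells. -/
theorem card_gridCell_ne_mul_spacing_le {a : ℕ} (ha : 0 < a) (v w : C.nodes) :
    (((Finset.range a).filter fun u => C.gridCell a u v ≠ C.gridCell a u w).card : ℝ) *
      M.spacing ≤ 2 * dist (v : EuclideanSpace ℝ (Fin 2)) (w : EuclideanSpace ℝ (Fin 2)) := by
  classical
  -- Along the diagonal each coordinate runs through all `a` shifts, so a union bound over the two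
  -- coordinates suffices. The factor `2` bounds the `ℓ¹` distance by the Euclidean one.
  have hsub : ((Finset.range a).filter fun u => C.gridCell a u v ≠ C.gridCell a u w) ⊆
      ((Finset.range a).filter fun u : ℕ =>
        (C.latticeCoord v 0 + u) / (a : ℤ) ≠ (C.latticeCoord w 0 + u) / (a : ℤ)) ∪
      ((Finset.range a).filter fun u : ℕ =>
        (C.latticeCoord v 1 + u) / (a : ℤ) ≠ (C.latticeCoord w 1 + u) / (a : ℤ)) := by
    intro u hu
    simp only [gridCell, ne_eq, Finset.mem_filter, Prod.mk.injEq, not_and_or,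
      Finset.mem_union] at hu ⊢
    tauto
  have h := (Finset.card_le_card hsub).trans (Finset.card_union_le _ _)
  have h0 := card_ediv_ne_le ha (C.latticeCoord v 0) (C.latticeCoord w 0)
  have h1 := card_ediv_ne_le ha (C.latticeCoord v 1) (C.latticeCoord w 1)
  have hc : (((Finset.range a).filter fun u => C.gridCell a u v ≠ C.gridCell a u w).card : ℤ) ≤
      |C.latticeCoord v 0 - C.latticeCoord w 0| + |C.latticeCoord v 1 - C.latticeCoord w 1| := by
    refine le_trans ?_ (add_le_add h0 h1)
    exact_mod_cast h
  have hc' : (((Finset.range a).filter fun u => C.gridCell a u v ≠ C.gridCell a u w).card : ℝ) ≤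
      ((|C.latticeCoord v 0 - C.latticeCoord w 0| : ℤ) : ℝ) +
        ((|C.latticeCoord v 1 - C.latticeCoord w 1| : ℤ) : ℝ) := by
    exact_mod_cast hc
  have := mul_le_mul_of_nonneg_right hc' M.spacing_pos.le
  linarith [C.abs_latticeCoord_sub_mul_spacing_le v w 0,
    C.abs_latticeCoord_sub_mul_spacing_le v w 1]

end Circuit

/-! ### From crossing bits to bit-meters. -/

/-- If, for each shifted grid, more than `T` bits are exchanged between different cells, then the
number of bit-meters is large. -/
theorem FixedLengthComputation.mul_le_bitMeters {M : ImplementationModel} {C : Circuit M} {n k : ℕ}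
    (D : FixedLengthComputation C n k) {a : ℕ} (ha : 0 < a) {T : ℝ}
    (h : ∀ u ∈ Finset.range a, T ≤
      ((∑ t with C.gridCell a u (D.src t) ≠ C.gridCell a u (D.dst t), D.size t : ℕ) : ℝ)) :
    a * T * M.spacing ≤ 2 * D.bitMeters := by
  -- Double counting: each message is counted once for every shift separating its endpoints.
  have hswap : ∑ u ∈ Finset.range a,
      ((∑ t with C.gridCell a u (D.src t) ≠ C.gridCell a u (D.dst t), D.size t : ℕ) : ℝ) =
      ∑ t, (D.size t : ℝ) * ((Finset.range a).filter fun u =>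
        C.gridCell a u (D.src t) ≠ C.gridCell a u (D.dst t)).card := by
    simp_rw [Finset.sum_filter, Nat.cast_sum]
    rw [Finset.sum_comm]
    refine Finset.sum_congr rfl fun t _ => ?_
    rw [Finset.card_filter, Nat.cast_sum, Finset.mul_sum]
    refine Finset.sum_congr rfl fun u _ => ?_
    split_ifs <;> simp
  have hT := Finset.sum_le_sum h
  rw [hswap, Finset.sum_const, Finset.card_range, nsmul_eq_mul] at hT
  refine (mul_le_mul_of_nonneg_right hT M.spacing_pos.le).trans ?_
  unfold FixedLengthComputation.bitMeters
  rw [Finset.sum_mul, Finset.mul_sum]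
  refine Finset.sum_le_sum fun t _ => ?_
  have := mul_le_mul_of_nonneg_left
    (C.card_gridCell_ne_mul_spacing_le ha (D.src t) (D.dst t)) (Nat.cast_nonneg (α := ℝ) (D.size t))
  linarith

/-- Either the bit-meters are large or correct decoding is unlikely. -/
theorem FixedLengthComputation.le_bitMeters_of_exp_lt_successProb {M : ImplementationModel}
    {C : Circuit M} {n k : ℕ} (D : FixedLengthComputation C n k) {p : ℝ} (hp0 : 0 ≤ p)
    (hp : p ≤ 1 / 2) (enc : (Fin k → Bool) → (Fin n → Bool)) {a : ℕ} (ha : 0 < a)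
    (h : Real.exp (-(k * (2 * p) ^ (a * a) / (4 * ((a * a : ℕ) : ℝ)))) <
      successProb p enc D.output) :
    a * k / 4 * M.spacing ≤ D.bitMeters := by
  classical
  -- A shift with fewer than `k / 2` crossing bits would satisfy `successProb_le_exp` and contradict
  -- `h`.
  have := D.mul_le_bitMeters ha (T := k / 2) fun u _ => by
    by_contra! hlt
    have : Fintype (Set.range (C.gridCell a u)) := (C.finite_range_gridCell ha u).fintype
    let f : C.nodes → Set.range (C.gridCell a u) := Set.rangeFactorization _
    have hf : ∀ v w, f v = f w ↔ C.gridCell a u v = C.gridCell a u w := fun v w =>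
      Subtype.ext_iff
    refine h.not_ge (D.successProb_le_exp f hp0 hp enc (Nat.mul_pos ha ha) (fun c => ?_)
      (fun c => ?_) ?_)
    · refine le_trans (le_of_eq ?_) (C.card_gridCell_eq_le ha u D.inputNode_injective c)
      exact Fintype.card_congr (Equiv.subtypeEquivRight fun j => Subtype.ext_iff)
    · refine le_trans (le_of_eq ?_) (C.card_gridCell_eq_le ha u D.outputNode_injective c)
      exact Fintype.card_congr (Equiv.subtypeEquivRight fun j => Subtype.ext_iff)
    · rw [D.sum_incomingBits f]
      refine le_trans (le_of_eq ?_) hlt.le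
      simp [hf]
  linarith

/-! ### Asymptotics of the two error bounds. -/

theorem exp_neg_log_one_div {q : ℝ} (hq : 0 < q) : Real.exp (-Real.log (1 / q)) = q := by
  rw [one_div, Real.log_inv, neg_neg, Real.exp_log hq]

/-- The strong converse for a channel that is very noisy compared with the rate. -/
theorem successProb_le_exp_of_log_le {n k : ℕ} {p R : ℝ} (hp0 : 0 < p) (hp : p ≤ 1 / 2)
    (hk : R * n ≤ k) (hL : Real.log (1 / (2 * p)) ≤ R / 2 * Real.log 2)
    (enc : (Fin k → Bool) → (Fin n → Bool)) (dec : (Fin n → Bool) → (Fin k → Bool)) :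
    successProb p enc dec ≤ Real.exp (-(R * n / 2 * Real.log 2)) := by
  refine (successProb_le_pow hp0.le hp enc dec).trans ?_
  have h2 : (1 / 2 : ℝ) = Real.exp (-Real.log 2) := by
    rw [Real.exp_neg, Real.exp_log (by norm_num), one_div]
  -- With `L = log (1 / (2p))`: `2p = exp (-L) ≥ 1 - L`, hence `2 - 2p ≤ 1 + L`.
  have hq : 2 - 2 * p ≤ Real.exp (R / 2 * Real.log 2) := by
    have h := Real.add_one_le_exp (-Real.log (1 / (2 * p)))
    rw [exp_neg_log_one_div (by positivity)] at h
    have h' := Real.add_one_le_exp (R / 2 * Real.log 2)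
    linarith
  calc (1 / 2 : ℝ) ^ k * (2 - 2 * p) ^ n
      ≤ Real.exp (-Real.log 2) ^ k * Real.exp (R / 2 * Real.log 2) ^ n := by
        rw [← h2]
        exact mul_le_mul_of_nonneg_left (pow_le_pow_left₀ (by linarith) hq n) (by positivity)
    _ = Real.exp (-(k * Real.log 2) + n * (R / 2 * Real.log 2)) := by
        rw [← Real.exp_nat_mul, ← Real.exp_nat_mul, ← Real.exp_add]
        ring_nf
    _ ≤ _ := by
        rw [Real.exp_le_exp]
        have := mul_le_mul_of_nonneg_right hk (Real.log_nonneg (by norm_num : (1 : ℝ) ≤ 2))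
        linarith

/-- With cells of at most `log n / (16 log (1 / q))` nodes, the error exponent of the cellwise
decoding bound grows at least like `√n`. -/
theorem sqrt_le_cell_exponent {n k : ℕ} {q R : ℝ} (hR : 0 < R) (hn : 2 ≤ n) (hq : 0 < q)
    (hk : R * n ≤ k) (hL : R / 2 * Real.log 2 < Real.log (1 / q)) {A : ℕ} (hA : 0 < A)
    (hA' : (A : ℝ) * (16 * Real.log (1 / q)) ≤ Real.log n) :
    7 / 8 * R ^ 2 * Real.log 2 * Real.sqrt n ≤ k * q ^ A / (4 * A) := by
  have hn' : (2 : ℝ) ≤ n := by exact_mod_cast hn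
  have hn0 : (0 : ℝ) < n := by linarith
  have hA0 : (0 : ℝ) < A := by exact_mod_cast hA
  have hlog2 : 0 < Real.log 2 := Real.log_pos (by norm_num)
  have hqA : (n : ℝ) ^ (-(1 / 16) : ℝ) ≤ q ^ A := by
    have h1 : q ^ A = Real.exp (-(A * Real.log (1 / q))) := by
      conv_lhs => rw [← exp_neg_log_one_div hq]
      rw [← Real.exp_nat_mul]
      ring_nf
    rw [h1, Real.rpow_def_of_pos hn0, Real.exp_le_exp]
    linarith
  -- The exponent `7/16` is what is left when `√n` is to be kept from `n ^ (1 - 1/16)`.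
  have hlog : Real.log n ≤ (n : ℝ) ^ (7 / 16 : ℝ) / (7 / 16) :=
    Real.log_le_rpow_div hn0.le (by norm_num)
  have hAn : (A : ℝ) * (8 * R * Real.log 2) ≤ (n : ℝ) ^ (7 / 16 : ℝ) / (7 / 16) := by
    refine le_trans ?_ (hA'.trans hlog)
    exact mul_le_mul_of_nonneg_left (by linarith) hA0.le
  rw [le_div_iff₀ (by positivity)]
  have hsplit : Real.sqrt n * (n : ℝ) ^ (7 / 16 : ℝ) = n * (n : ℝ) ^ (-(1 / 16) : ℝ) := by
    rw [Real.sqrt_eq_rpow, ← Real.rpow_add hn0]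
    nth_rewrite 2 [← Real.rpow_one (n : ℝ)]
    rw [← Real.rpow_add hn0]
    norm_num
  calc 7 / 8 * R ^ 2 * Real.log 2 * Real.sqrt n * (4 * A)
      = 7 / 16 * R * Real.sqrt n * (A * (8 * R * Real.log 2)) := by ring
    _ ≤ 7 / 16 * R * Real.sqrt n * ((n : ℝ) ^ (7 / 16 : ℝ) / (7 / 16)) :=
        mul_le_mul_of_nonneg_left hAn (by positivity)
    _ = R * (Real.sqrt n * (n : ℝ) ^ (7 / 16 : ℝ)) := by ring
    _ = R * n * (n : ℝ) ^ (-(1 / 16) : ℝ) := by rw [hsplit]; ring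
    _ ≤ k * q ^ A := mul_le_mul hk hqA (by positivity) (by positivity)

theorem exists_forall_exp_neg_lt {R δ : ℝ} (hR : 0 < R) (hδ : 0 < δ) :
    ∃ N : ℕ, ∀ n : ℕ, N ≤ n → 2 ≤ n ∧ Real.exp (-(R * n / 2 * Real.log 2)) < δ ∧
      Real.exp (-(7 / 8 * R ^ 2 * Real.log 2 * Real.sqrt n)) < δ := by
  have hlog2 : 0 < Real.log 2 := Real.log_pos (by norm_num)
  have hcast := tendsto_natCast_atTop_atTop (R := ℝ)
  have h1 : Filter.Tendsto (fun n : ℕ => Real.exp (-(R * n / 2 * Real.log 2))) Filter.atTop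
      (nhds 0) := by
    refine Real.tendsto_exp_neg_atTop_nhds_zero.comp ?_
    exact ((hcast.const_mul_atTop hR).atTop_div_const (by norm_num)).atTop_mul_const hlog2
  have h2 : Filter.Tendsto
      (fun n : ℕ => Real.exp (-(7 / 8 * R ^ 2 * Real.log 2 * Real.sqrt n))) Filter.atTop
      (nhds 0) := by
    refine Real.tendsto_exp_neg_atTop_nhds_zero.comp ?_
    exact (Real.tendsto_sqrt_atTop.comp hcast).const_mul_atTop (by positivity)
  obtain ⟨N, hN⟩ := Filter.eventually_atTop.1 ((Filter.eventually_ge_atTop 2).and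
    ((h1.eventually_lt_const hδ).and (h2.eventually_lt_const hδ)))
  exact ⟨N, hN⟩

end InfoFriction

end

theorem theorem3 (R δ : ℝ) (hR : 0 < R) (hδ : 0 < δ) :
    ∃ N : ℕ, ∀ n k : ℕ, N ≤ n → R * (n : ℝ) ≤ (k : ℝ) →
      ∀ zeta sigmaSq P : ℝ, 0 < zeta → 0 < sigmaSq → 0 < P →
      100 * Real.log (1 / (2 * InfoFriction.crossover zeta sigmaSq P)) < Real.log (n : ℝ) →
      ∀ (M : InfoFriction.ImplementationModel) (C : InfoFriction.Circuit M)
        (enc : (Fin k → Bool) → (Fin n → Bool))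
        (D : InfoFriction.FixedLengthComputation C n k),
        InfoFriction.blockErrorProb (InfoFriction.crossover zeta sigmaSq P) enc D.output ≤ 1 - δ →
        (k : ℝ) / 192 *
            Real.sqrt (Real.log (n : ℝ) /
              Real.log (1 / (2 * InfoFriction.crossover zeta sigmaSq P))) * M.spacing
          ≤ D.bitMeters := by
  obtain ⟨N, hN⟩ := InfoFriction.exists_forall_exp_neg_lt hR hδ
  refine ⟨N, fun n k hn hk zeta sigmaSq P _ _ _ hlog M C enc D herr => ?_⟩
  obtain ⟨hn2, hN1, hN2⟩ := hN n hn
  have hp0 : 0 < InfoFriction.crossover zeta sigmaSq P := InfoFriction.gaussianTail_pos _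
  have hp : InfoFriction.crossover zeta sigmaSq P ≤ 1 / 2 :=
    InfoFriction.gaussianTail_le_half (Real.sqrt_nonneg _)
  generalize InfoFriction.crossover zeta sigmaSq P = p at *
  rw [InfoFriction.blockErrorProb_eq] at herr
  have hsucc : δ ≤ InfoFriction.successProb p enc D.output := by linarith
  -- The strong converse rules out very noisy channels, including `p = 1 / 2`, where the logarithm
  -- vanishes.
  have hL : R / 2 * Real.log 2 < Real.log (1 / (2 * p)) := by
    by_contra! hL
    exact (hN1.trans_le hsucc).not_ge
      (InfoFriction.successProb_le_exp_of_log_le hp0 hp hk hL enc D.output)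
  have hlog2 : 0 < Real.log 2 := Real.log_pos (by norm_num)
  have hL0 : 0 < Real.log (1 / (2 * p)) := lt_trans (by positivity) hL
  set s : ℝ := Real.sqrt (Real.log n / Real.log (1 / (2 * p))) with hs
  -- The constant `100` enters here; it makes the cell side `⌊s / 4⌋₊` positive.
  have hs10 : 10 < s := Real.lt_sqrt_of_sq_lt (by rw [lt_div_iff₀ hL0]; linarith)
  have hs2 : s ^ 2 * Real.log (1 / (2 * p)) = Real.log n := by
    rw [hs, Real.sq_sqrt (div_nonneg (by linarith) hL0.le), div_mul_cancel₀ _ hL0.ne']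
  have ha_le : (⌊s / 4⌋₊ : ℝ) ≤ s / 4 := Nat.floor_le (by linarith)
  have ha_lt : s / 4 < ⌊s / 4⌋₊ + 1 := Nat.lt_floor_add_one _
  have ha : 0 < ⌊s / 4⌋₊ := Nat.floor_pos.2 (by linarith)
  generalize ⌊s / 4⌋₊ = a at *
  have hA' : ((a * a : ℕ) : ℝ) * (16 * Real.log (1 / (2 * p))) ≤ Real.log n := by
    rw [← hs2]
    push_cast
    have := mul_self_le_mul_self (Nat.cast_nonneg a) ha_le
    nlinarith
  have hexp := InfoFriction.sqrt_le_cell_exponent hR hn2 (by positivity) hk hL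
    (Nat.mul_pos ha ha) hA'
  have hmain := D.le_bitMeters_of_exp_lt_successProb hp0.le hp enc ha
    (lt_of_le_of_lt (Real.exp_le_exp.2 (neg_le_neg hexp)) (hN2.trans_le hsucc))
  refine le_trans (mul_le_mul_of_nonneg_right ?_ M.spacing_pos.le) hmain
  have hk0 : (0 : ℝ) ≤ k := Nat.cast_nonneg k
  -- From `a > s / 4 - 1` and `s > 10`; with the factor `1 / 4` of `hmain` this yields `192 = 4 *
  -- 48`.
  have : s / 48 ≤ a := by linarith
  linarith [mul_le_mul_of_nonneg_left this hk0]
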